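/- Let $R$ be a commutative ring. Let $\mathbf P(R)$ and $\mathbf{Free}(R)$ be the exact categories of finitely generated projective, respectively finitely generated free, $R$-modules. For $\mathcal C=\mathbf P(R)$ or $\mathbf{Free}(R)$ let $\mathbf{Nil}(\mathcal C)$ be the exact category of pairs $(X,\nu)$ with $X$ in $\mathcal C$ and $\nu$ a nilpotent endomorphism of $X$; its morphisms are the $R$-linear maps commuting with the endomorphisms, and a sequence in it is short exact if the underlying sequence of $R$-modules is. Write $\mathbf{Nil}(R)=\mathbf{Nil}(\mathbf P(R))$. For an exact category $\mathcal N$, let $B^q\mathcal N$ be the category of bounded acyclic binary complexes $(N_*,d,d')$ in $\mathcal N$: $N_*$ is a bounded $\mathbb Z$-graded object of $\mathcal N$, and $d,d'$ are two differentials of degree $-1$, each of which is acyclic, that is, $d_i\colon N_i\to N_{i-1}$ factors as $N_i\to Z_{i-1}\to N_{i-1}$ with all $Z_i$ in $\mathcal N$ and all $0\to Z_i\to N_i\to Z_{i-1}\to 0$ short exact in $\mathcal N$ (and likewise for $d'$). Morphisms commute with both differentials, and a sequence in $B^q\mathcal N$ is short exact if it is so in each degree. Let $K_1\mathcal N$ be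 the abelian group with one generator $[N]$ for each object $N$ of $B^q\mathcal N$ and the relations $[N']+[N'']=[N]$ for every short exact sequence $0\to N'\to N\to N''\to 0$ in $B^q\mathcal N$ and $[T]=0$ for every $T=(T_*,d,d')$ in $B^q\mathcal N$ with $d=d'$. Write an object of $B^q\mathbf{Nil}(\mathcal C)$ as $(F_*,f,f',\nu)$. Finally let $$\mathrm{Nil}_1(R)=\ker\bigl(K_1\mathbf{Nil}(R)\to K_1\mathbf P(R)\bigr),\qquad [(P_*,p,p',\nu)]\mapsto[(P_*,p,p')].$$ **Theorem.** The subgroup $\mathrm{Nil}_1(R)$ of $K_1\mathbf{Nil}(R)$ is generated by the elements $$[(F_*,f,f',\nu)]-[(F_*,f,f',0)],$$ where $(F_*,f,f',\nu)$ and $(F_*,f,f',0)$ are objects of $B^q\mathbf{Nil}(\mathbf{Free}(R))$ and $f\neq f'$. -/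

import Mathlib

open CategoryTheory CategoryTheory.Limits

universe v v' u u'

/-- The class of short exact sequences of an exact category. The constructions below use only this
class; every category to which they are applied in the end is a category of modules, possibly with
extra structure, and there the short exact sequences are exactly those sequences whose underlying
sequence of modules is short exact. -/
class ExactSequences (C : Type u) [Category.{v} C] [HasZeroMorphisms C] where
  /-- `IsSES S` says that `0 ⟶ S.X₁ ⟶ S.X₂ ⟶ S.X₃ ⟶ 0` is a short exact sequence. -/
  IsSES : ShortComplex C → Prop

/-- `IsSES S` says that `0 ⟶ S.X₁ ⟶ S.X₂ ⟶ S.X₃ ⟶ 0` is a short exact sequence of the exact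
category `C`. -/
def IsSES {C : Type u} [Category.{v} C] [HasZeroMorphisms C] [ExactSequences C]
    (S : ShortComplex C) : Prop :=
  ExactSequences.IsSES S

/-- An exact functor: it maps short exact sequences to short exact sequences. -/
class IsExactFunctor {C : Type u} [Category.{v} C] [HasZeroMorphisms C] [ExactSequences C]
    {D : Type u'} [Category.{v'} D] [HasZeroMorphisms D] [ExactSequences D]
    (F : C ⥤ D) [F.PreservesZeroMorphisms] : Prop where
  map_isSES (S : ShortComplex C) : IsSES S → IsSES (S.map F)

/-! ### Full subcategories of abelian categories -/

section FullSubcategory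

variable {A : Type u} [Category.{v} A] [Abelian A]

instance (P : ObjectProperty A) : P.ι.PreservesZeroMorphisms where
  map_zero _ _ := rfl

/-- In a full subcategory of an abelian category, a sequence is short exact if it is so in the
abelian category. -/
instance ObjectProperty.exactSequences (P : ObjectProperty A) :
    ExactSequences P.FullSubcategory where
  IsSES S := (S.map P.ι).ShortExact

variable {P Q : ObjectProperty A} (h : P ≤ Q)

instance : (ObjectProperty.ιOfLE h).PreservesZeroMorphisms where
  map_zero _ _ := rfl

instance : IsExactFunctor (ObjectProperty.ιOfLE h) where
  map_isSES _ hS := hS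

end FullSubcategory

/-! ### Objects with a nilpotent endomorphism -/

/-- The objects `(X, ν)` of `Nil(C)`: an object `X` of `C` with a nilpotent endomorphism `ν`. -/
structure NilCat (C : Type u) [Category.{v} C] [Preadditive C] where
  /-- the underlying object -/
  X : C
  /-- the endomorphism -/
  ν : X ⟶ X
  nilpotent : IsNilpotent (End.of ν)

namespace NilCat

section

variable {C : Type u} [Category.{v} C] [Preadditive C]

/-- A morphism of `Nil(C)` is a morphism of `C` that commutes with the endomorphisms. -/
@[ext]
structure Hom (M N : NilCat C) where
  /-- the underlying morphism -/
  f : M.X ⟶ N.X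
  comm : M.ν ≫ f = f ≫ N.ν

instance : Category.{v} (NilCat C) where
  Hom := Hom
  id M := ⟨𝟙 M.X, by simp⟩
  comp g h := ⟨g.f ≫ h.f, by rw [← Category.assoc, g.comm, Category.assoc, h.comm, Category.assoc]⟩
  id_comp g := Hom.ext (Category.id_comp g.f)
  comp_id g := Hom.ext (Category.comp_id g.f)
  assoc g h k := Hom.ext (Category.assoc g.f h.f k.f)

instance : HasZeroMorphisms (NilCat C) where
  zero M N := ⟨⟨0, by simp⟩⟩
  comp_zero g K := Hom.ext (comp_zero (f := g.f))
  zero_comp M _ _ g := Hom.ext (zero_comp (f := g.f))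

variable (C) in
/-- The forgetful functor `(X, ν) ↦ X`. -/
def forget : NilCat C ⥤ C where
  obj M := M.X
  map g := g.f

instance : (forget C).PreservesZeroMorphisms where
  map_zero _ _ := rfl

variable (C) in
/-- The functor `X ↦ (X, 0)`. -/
def zero : C ⥤ NilCat C where
  obj X := ⟨X, 0, IsNilpotent.zero⟩
  map g := ⟨g, by simp⟩

instance : (zero C).PreservesZeroMorphisms where
  map_zero _ _ := rfl

variable [ExactSequences C]

/-- A sequence in `Nil(C)` is short exact if the underlying sequence in `C` is so. -/
instance : ExactSequences (NilCat C) where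
  IsSES S := IsSES (S.map (forget C))

instance : IsExactFunctor (forget C) where
  map_isSES _ hS := hS

instance : IsExactFunctor (zero C) where
  map_isSES _ hS := hS

end

section

variable {C : Type u} [Category.{v} C] [Preadditive C] [ExactSequences C]
  {D : Type u'} [Category.{v'} D] [Preadditive D] [ExactSequences D]
  (F : C ⥤ D) [F.Additive]

/-- The functor `Nil(C) ⥤ Nil(D)` induced by an additive functor `F`, which sends `(X, ν)` to
`(F X, F ν)`. -/
def map : NilCat C ⥤ NilCat D where
  obj M := ⟨F.obj M.X, F.map M.ν, by
    obtain ⟨n, hn⟩ := M.nilpotent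
    exact ⟨n, by
      have := congrArg (F.mapEnd M.X) hn
      rw [map_pow] at this
      exact this.trans (F.map_zero _ _)⟩⟩
  map g := ⟨F.map g.f, by rw [← F.map_comp, g.comm, F.map_comp]⟩
  map_id M := Hom.ext (F.map_id M.X)
  map_comp g h := Hom.ext (F.map_comp g.f h.f)

instance : (map F).PreservesZeroMorphisms where
  map_zero _ _ := Hom.ext (F.map_zero _ _)

instance [IsExactFunctor F] : IsExactFunctor (map F) where
  map_isSES S hS := IsExactFunctor.map_isSES (F := F) (S.map (forget C)) hS

end

end NilCat

/-! ### Acyclic binary complexes -/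

/-- A bounded binary chain complex `(X_*, d, d')` in `C`: a bounded `ℤ`-graded object with two
differentials of degree `-1`. The differential from degree `i + 1` to degree `i` is `d i`. -/
structure BinaryComplex (C : Type u) [Category.{v} C] [HasZeroMorphisms C] where
  /-- the graded object -/
  X : ℤ → C
  /-- the first differential -/
  d (i : ℤ) : X (i + 1) ⟶ X i
  /-- the second differential -/
  d' (i : ℤ) : X (i + 1) ⟶ X i
  d_comp_d (i : ℤ) : d (i + 1) ≫ d i = 0
  d'_comp_d' (i : ℤ) : d' (i + 1) ≫ d' i = 0
  bounded : ∃ a b : ℤ, ∀ i : ℤ, i < a ∨ b < i → IsZero (X i)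

/-- The acyclicity of a chain complex `(X_*, d)` in an exact category: each differential
`X_{i+1} ⟶ X_i` factors as `X_{i+1} ⟶ Z_i ⟶ X_i` such that all `0 ⟶ Z_i ⟶ X_i ⟶ Z_{i-1} ⟶ 0` are
short exact sequences of the exact category (in particular, the `Z_i` are objects of it). -/
def IsAcyclic {C : Type u} [Category.{v} C] [HasZeroMorphisms C] [ExactSequences C]
    (X : ℤ → C) (d : ∀ i : ℤ, X (i + 1) ⟶ X i) : Prop :=
  ∃ (Z : ℤ → C) (p : ∀ i : ℤ, X (i + 1) ⟶ Z i) (j : ∀ i : ℤ, Z i ⟶ X i),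
    (∀ i : ℤ, p i ≫ j i = d i) ∧
    ∀ i : ℤ, ∃ w : j (i + 1) ≫ p i = 0, IsSES (ShortComplex.mk (j (i + 1)) (p i) w)

namespace BinaryComplex

section

variable {C : Type u} [Category.{v} C] [HasZeroMorphisms C]

/-- A morphism of binary complexes is a morphism of graded objects that commutes with both
differentials. -/
@[ext]
structure Hom (M N : BinaryComplex C) where
  /-- the components -/
  f (i : ℤ) : M.X i ⟶ N.X i
  comm (i : ℤ) : M.d i ≫ f i = f (i + 1) ≫ N.d i
  comm' (i : ℤ) : M.d' i ≫ f i = f (i + 1) ≫ N.d' i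

instance : Category (BinaryComplex C) where
  Hom := Hom
  id M := ⟨fun i => 𝟙 (M.X i), by simp, by simp⟩
  comp g h := ⟨fun i => g.f i ≫ h.f i,
    fun i => by rw [← Category.assoc, g.comm, Category.assoc, h.comm, Category.assoc],
    fun i => by rw [← Category.assoc, g.comm', Category.assoc, h.comm', Category.assoc]⟩
  id_comp g := Hom.ext (funext fun i => Category.id_comp (g.f i))
  comp_id g := Hom.ext (funext fun i => Category.comp_id (g.f i))
  assoc g h k := Hom.ext (funext fun i => Category.assoc (g.f i) (h.f i) (k.f i))

instance : HasZeroMorphisms (BinaryComplex C) where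
  zero M N := ⟨⟨fun _ => 0, by simp, by simp⟩⟩
  comp_zero g K := Hom.ext (funext fun i => comp_zero (f := g.f i))
  zero_comp M _ _ g := Hom.ext (funext fun i => zero_comp (f := g.f i))

variable (C) in
/-- The functor that sends a binary complex to its object in degree `i`. -/
def eval (i : ℤ) : BinaryComplex C ⥤ C where
  obj M := M.X i
  map g := g.f i

instance (i : ℤ) : (eval C i).PreservesZeroMorphisms where
  map_zero _ _ := rfl

/-- A binary complex is diagonal if its two differentials agree. -/
def IsDiagonal (M : BinaryComplex C) : Prop :=
  M.d = M.d'

variable (C) in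
/-- A binary complex is acyclic if it is so for each of its two differentials. -/
def acyclic [ExactSequences C] : ObjectProperty (BinaryComplex C) :=
  fun M => IsAcyclic M.X M.d ∧ IsAcyclic M.X M.d'

end

section

variable {C : Type u} [Category.{v} C] [HasZeroMorphisms C]
  {D : Type u'} [Category.{v'} D] [HasZeroMorphisms D]
  (F : C ⥤ D) [F.PreservesZeroMorphisms]

/-- The functor that applies `F` to the objects and to both differentials of a binary complex. -/
def map : BinaryComplex C ⥤ BinaryComplex D where
  obj M :=
    { X := fun i => F.obj (M.X i)
      d := fun i => F.map (M.d i)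
      d' := fun i => F.map (M.d' i)
      d_comp_d := fun i => by rw [← F.map_comp, M.d_comp_d, F.map_zero]
      d'_comp_d' := fun i => by rw [← F.map_comp, M.d'_comp_d', F.map_zero]
      bounded := by
        obtain ⟨a, b, h⟩ := M.bounded
        exact ⟨a, b, fun i hi => F.map_isZero (h i hi)⟩ }
  map g := ⟨fun i => F.map (g.f i),
    fun i => by rw [← F.map_comp, g.comm, F.map_comp],
    fun i => by rw [← F.map_comp, g.comm', F.map_comp]⟩
  map_id M := Hom.ext (funext fun i => F.map_id (M.X i))
  map_comp g h := Hom.ext (funext fun i => F.map_comp (g.f i) (h.f i))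

instance : (map F).PreservesZeroMorphisms where
  map_zero _ _ := Hom.ext (funext fun _ => F.map_zero _ _)

end

end BinaryComplex

theorem IsAcyclic.map {C : Type u} [Category.{v} C] [HasZeroMorphisms C] [ExactSequences C]
    {D : Type u'} [Category.{v'} D] [HasZeroMorphisms D] [ExactSequences D]
    (F : C ⥤ D) [F.PreservesZeroMorphisms] [IsExactFunctor F]
    {X : ℤ → C} {d : ∀ i : ℤ, X (i + 1) ⟶ X i} (h : IsAcyclic X d) :
    IsAcyclic (fun i => F.obj (X i)) (fun i => F.map (d i)) := by
  obtain ⟨Z, p, j, hd, hS⟩ := h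
  refine ⟨fun i => F.obj (Z i), fun i => F.map (p i), fun i => F.map (j i), fun i => ?_,
    fun i => ?_⟩
  · rw [← F.map_comp, hd]
  · obtain ⟨w, hw⟩ := hS i
    exact ⟨by rw [← F.map_comp, w, F.map_zero], IsExactFunctor.map_isSES (F := F) _ hw⟩

/-- The category `B^q(C)` of bounded acyclic binary complexes in `C`, a full subcategory of the
category of bounded binary complexes. -/
abbrev AcyclicBinary (C : Type u) [Category.{v} C] [HasZeroMorphisms C] [ExactSequences C] :
    Type (max u v) :=
  (BinaryComplex.acyclic C).FullSubcategory

namespace AcyclicBinary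

section

variable {C : Type u} [Category.{v} C] [HasZeroMorphisms C] [ExactSequences C]

variable (C) in
/-- The functor that sends an acyclic binary complex to its object in degree `i`. -/
def eval (i : ℤ) : AcyclicBinary C ⥤ C :=
  (BinaryComplex.acyclic C).ι ⋙ BinaryComplex.eval C i

instance (i : ℤ) : (eval C i).PreservesZeroMorphisms where
  map_zero _ _ := rfl

/-- A sequence of acyclic binary complexes is short exact if it is so in each degree. -/
instance : ExactSequences (AcyclicBinary C) where
  IsSES S := ∀ i : ℤ, IsSES (S.map (eval C i))

end

section

variable {C : Type u} [Category.{v} C] [HasZeroMorphisms C] [ExactSequences C]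
  {D : Type u'} [Category.{v'} D] [HasZeroMorphisms D] [ExactSequences D]
  (F : C ⥤ D) [F.PreservesZeroMorphisms] [IsExactFunctor F]

/-- The functor `B^q(C) ⥤ B^q(D)` induced by an exact functor `F`. -/
def map : AcyclicBinary C ⥤ AcyclicBinary D :=
  ObjectProperty.lift _ ((BinaryComplex.acyclic C).ι ⋙ BinaryComplex.map F)
    fun M => ⟨M.property.1.map F, M.property.2.map F⟩

instance : (map F).PreservesZeroMorphisms where
  map_zero _ _ := ObjectProperty.hom_ext _ ((BinaryComplex.map F).map_zero _ _)

instance : IsExactFunctor (map F) where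
  map_isSES S hS i := IsExactFunctor.map_isSES (F := F) (S.map (eval C i)) (hS i)

end

end AcyclicBinary

/-! ### Grayson's presentation of `K₁` -/

/-- The relations that define `K₁` of an exact category: `[S.X₁] + [S.X₃] = [S.X₂]` for each short
exact sequence `S` of acyclic binary complexes, and `[T] = 0` for each diagonal one. -/
def K1Relations (C : Type u) [Category.{v} C] [HasZeroMorphisms C] [ExactSequences C] :
    Set (FreeAbelianGroup (AcyclicBinary C)) :=
  {x | ∃ S : ShortComplex (AcyclicBinary C), IsSES S ∧
      x = FreeAbelianGroup.of S.X₁ + FreeAbelianGroup.of S.X₃ - FreeAbelianGroup.of S.X₂} ∪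
  {x | ∃ T : AcyclicBinary C, T.obj.IsDiagonal ∧ x = FreeAbelianGroup.of T}

/-- The group `K₁(C)` of an exact category `C` by generators and relations. -/
abbrev K1 (C : Type u) [Category.{v} C] [HasZeroMorphisms C] [ExactSequences C] :
    Type (max u v) :=
  FreeAbelianGroup (AcyclicBinary C) ⧸ AddSubgroup.closure (K1Relations C)

namespace K1

section

variable {C : Type u} [Category.{v} C] [HasZeroMorphisms C] [ExactSequences C]

/-- The class `[M]` in `K₁(C)` of an acyclic binary complex `M`. -/
def mk (M : AcyclicBinary C) : K1 C :=
  QuotientAddGroup.mk (FreeAbelianGroup.of M)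

end

section

variable {C : Type u} [Category.{v} C] [HasZeroMorphisms C] [ExactSequences C]
  {D : Type u'} [Category.{v'} D] [HasZeroMorphisms D] [ExactSequences D]
  (F : C ⥤ D) [F.PreservesZeroMorphisms] [IsExactFunctor F]

/-- The homomorphism `K₁(C) →+ K₁(D)`, `[M] ↦ [F M]`, induced by an exact functor `F`. -/
def map : K1 C →+ K1 D :=
  QuotientAddGroup.map _ _ (FreeAbelianGroup.map (AcyclicBinary.map F).obj) <| by
    rw [AddSubgroup.closure_le]
    rintro x (⟨S, hS, rfl⟩ | ⟨T, hT, rfl⟩)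
    · refine AddSubgroup.subset_closure (Or.inl ⟨S.map (AcyclicBinary.map F),
        IsExactFunctor.map_isSES (F := AcyclicBinary.map F) S hS, ?_⟩)
      simp
    · refine AddSubgroup.subset_closure (Or.inr ⟨(AcyclicBinary.map F).obj T, ?_, ?_⟩)
      · exact congrArg (fun e => fun i => F.map (e i)) hT
      · simp

theorem map_mk (M : AcyclicBinary C) : map F (mk M) = mk ((AcyclicBinary.map F).obj M) :=
  congrArg QuotientAddGroup.mk (FreeAbelianGroup.map_of_apply M)

end

end K1

/-! ### The exact categories of modules, and `Nil₁` -/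

section Modules

variable (R : Type u) [CommRing R]

/-- The finitely generated projective `R`-modules. -/
def finProj : ObjectProperty (ModuleCat.{u} R) :=
  fun M => Module.Finite R M ∧ Module.Projective R M

/-- The finitely generated free `R`-modules. -/
def finFree : ObjectProperty (ModuleCat.{u} R) :=
  fun M => Module.Finite R M ∧ Module.Free R M

theorem finFree_le_finProj : finFree R ≤ finProj R :=
  fun _ ⟨h, _⟩ => ⟨h, inferInstance⟩

/-- The exact category `P(R)` of finitely generated projective `R`-modules. -/
abbrev ProjCat : Type (u + 1) :=
  (finProj R).FullSubcategory

/-- The exact category `Free(R)` of finitely generated free `R`-modules. -/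
abbrev FreeCat : Type (u + 1) :=
  (finFree R).FullSubcategory

/-- The inclusion of `Free(R)` in `P(R)`. -/
abbrev freeToProj : FreeCat R ⥤ ProjCat R :=
  ObjectProperty.ιOfLE (finFree_le_finProj R)

instance : (freeToProj R).Additive where
  map_add := rfl

/-- The group `Nil₁(R)`: the kernel of the homomorphism `K₁(Nil(P(R))) →+ K₁(P(R))` induced by the
forgetful functor `(P, ν) ↦ P`. -/
def Nil1 : AddSubgroup (K1 (NilCat (ProjCat R))) :=
  (K1.map (NilCat.forget (ProjCat R))).ker

variable {R}

/-- For an object `N = (F_*, f, f', ν)` of `B^q(Nil(Free(R)))`, its class `[(F_*, f, f', ν)]` in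
`K₁(Nil(P(R)))`. -/
def freeNilClass (N : AcyclicBinary (NilCat (FreeCat R))) : K1 (NilCat (ProjCat R)) :=
  K1.mk ((AcyclicBinary.map (NilCat.map (freeToProj R))).obj N)

/-- For an object `N = (F_*, f, f', ν)` of `B^q(Nil(Free(R)))`, the object `(F_*, f, f', 0)`. -/
def killNil (N : AcyclicBinary (NilCat (FreeCat R))) : AcyclicBinary (NilCat (FreeCat R)) :=
  (AcyclicBinary.map (NilCat.zero (FreeCat R))).obj
    ((AcyclicBinary.map (NilCat.forget (FreeCat R))).obj N)

end Modules

/-! ### Projective modules -/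

section Splitting

variable {R : Type u} [CommRing R]

/-! The functor `X ↦ (X, 0)` is an exact section of the forgetful functor, so `φ = id - zero ∘
forget` is a projection of `K₁ Nil(R)` onto `Nil₁(R)`. Hence `Nil₁(R)` is generated by the elements
`φ [M]`, and it suffices to represent every `[M]` by a complex `N` of free modules: then `φ [M] =
[N] - [killNil N]`, which vanishes if the two differentials of `N` agree.

To make `M` free, add the cone of the identity of a bounded graded projective module `Q_*`, with
zero endomorphism. The cone is diagonal, so the class does not change. Acyclicity over `Free(R)`
also requires free cycle modules, and the cycles `Z_i` of `d` and `Z'_i` of `d'` may differ, while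
the same `Q_i` has to complete both of them to free modules. Such a `Q_i` exists
(`exists_complements`): up to free modules, `Z_{i+1}` and `Z'_{i+1}` are both determined by
`X_{i+1}` and by the preceding cycles, and all cycles vanish below the support, so induction on the
degree applies (`exists_common_complement`). The remaining verification is `isAcyclic_prodZero`. -/

theorem Module.Projective.exists_prod_free (M : Type u) [AddCommGroup M] [Module R M]
    [Module.Finite R M] [Module.Projective R M] :
    ∃ C : ModuleCat.{u} R, Module.Finite R C ∧ Module.Projective R C ∧
      Module.Free R (M × C) := by
  obtain ⟨n, f, g, hf, -, hfg⟩ := Module.Finite.exists_comp_eq_id_of_projective R M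
  let e := ((f.exact_subtype_ker_map).splitSurjectiveEquiv
    (Submodule.injective_subtype _) ⟨g, hfg⟩).1
  refine ⟨ModuleCat.of R (LinearMap.ker f), ?_, ?_, ?_⟩
  · exact Module.Finite.of_surjective (LinearMap.fst R _ M ∘ₗ e.toLinearMap)
      (Prod.fst_surjective.comp e.surjective)
  · refine Module.Projective.of_split (e.symm.toLinearMap ∘ₗ LinearMap.inl R _ M)
      (LinearMap.fst R _ M ∘ₗ e.toLinearMap) ?_
    ext x
    simp
  · exact Module.Free.of_equiv (e.trans (LinearEquiv.prodComm R _ _))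

theorem nonempty_equiv_prod_of_exact {A B C : Type u} [AddCommGroup A] [Module R A]
    [AddCommGroup B] [Module R B] [AddCommGroup C] [Module R C] [Module.Projective R C]
    {f : A →ₗ[R] B} {g : B →ₗ[R] C} (hf : Function.Injective f) (h : Function.Exact f g)
    (hg : Function.Surjective g) : Nonempty (B ≃ₗ[R] A × C) := by
  obtain ⟨l, hl⟩ := Module.projective_lifting_property g LinearMap.id hg
  exact ⟨(h.splitSurjectiveEquiv hf ⟨l, hl⟩).1⟩

/-- If `Z` and `Z'` have a common free complement and `X` is an extension of `Z` by `W` and of `Z'`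
by `W'`, then `W` and `W'` have a common free complement. -/
theorem exists_common_complement {Z Z' W W' X Q : Type u}
    [AddCommGroup Z] [Module R Z] [AddCommGroup Z'] [Module R Z'] [AddCommGroup W] [Module R W]
    [AddCommGroup W'] [Module R W'] [AddCommGroup X] [Module R X] [AddCommGroup Q] [Module R Q]
    [Module.Finite R Z] [Module.Projective R Z] [Module.Finite R Z'] [Module.Projective R Z']
    [Module.Finite R X] [Module.Projective R X] [Module.Finite R Q] [Module.Projective R Q]
    (e : X ≃ₗ[R] W × Z) (e' : X ≃ₗ[R] W' × Z') [Module.Free R (Z × Q)] [Module.Free R (Z' × Q)] :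
    ∃ Q' : ModuleCat.{u} R, Module.Finite R Q' ∧ Module.Projective R Q' ∧
      Module.Free R (W × Q') ∧ Module.Free R (W' × Q') := by
  obtain ⟨C, hC, hC', hC''⟩ := Module.Projective.exists_prod_free (R := R) X
  -- With `C` a free complement of `X`, the sum `W ⊕ Q'` regroups as `(X ⊕ C) ⊕ (Z' ⊕ Q)` and `W' ⊕
  -- Q'` as `(X ⊕ C) ⊕ (Z ⊕ Q)`.
  refine ⟨ModuleCat.of R ((Z × Z') × (C × Q)), inferInstanceAs (Module.Finite R ((Z × Z') × C × Q)),
    inferInstanceAs (Module.Projective R ((Z × Z') × C × Q)), ?_, ?_⟩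
  · exact Module.Free.of_equiv (((e.prodCongr (LinearEquiv.refl R C)).prodCongr
      (LinearEquiv.refl R (Z' × Q))).trans
      ({  toFun := fun x => (x.1.1.1, (x.1.1.2, x.2.1), x.1.2, x.2.2)
          invFun := fun y => (((y.1, y.2.1.1), y.2.2.1), (y.2.1.2, y.2.2.2))
          left_inv := fun _ => rfl
          right_inv := fun _ => rfl
          map_add' := fun _ _ => rfl
          map_smul' := fun _ _ => rfl } :
        (((W × Z) × C) × (Z' × Q)) ≃ₗ[R] W × ((Z × Z') × C × Q)))
  · exact Module.Free.of_equiv (((e'.prodCongr (LinearEquiv.refl R C)).prodCongr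
      (LinearEquiv.refl R (Z × Q))).trans
      ({  toFun := fun x => (x.1.1.1, (x.2.1, x.1.1.2), x.1.2, x.2.2)
          invFun := fun y => (((y.1, y.2.1.2), y.2.2.1), (y.2.1.1, y.2.2.2))
          left_inv := fun _ => rfl
          right_inv := fun _ => rfl
          map_add' := fun _ _ => rfl
          map_smul' := fun _ _ => rfl } :
        (((W' × Z') × C) × (Z × Q)) ≃ₗ[R] W' × ((Z × Z') × C × Q)))

end Splitting

/-! ### Modules with a nilpotent endomorphism -/

namespace NilCat

variable {R : Type u} [CommRing R] {P : ObjectProperty (ModuleCat.{u} R)}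

/-- The linear endomorphism of an object of `Nil(C)`, for a category `C` of modules. -/
abbrev linν (M : NilCat P.FullSubcategory) : M.X.obj →ₗ[R] M.X.obj :=
  M.ν.hom.hom

/-- The linear map underlying a morphism of `Nil(C)`, for a category `C` of modules. -/
abbrev Hom.lin {M N : NilCat P.FullSubcategory} (g : M ⟶ N) : M.X.obj →ₗ[R] N.X.obj :=
  (Hom.f g).hom.hom

theorem Hom.lin_comm {M N : NilCat P.FullSubcategory} (g : M ⟶ N) (x : M.X.obj) :
    Hom.lin g (M.linν x) = N.linν (Hom.lin g x) :=
  congrArg (fun h : M.X ⟶ N.X => h.hom.hom x) (Hom.comm g)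

theorem Hom.ext_lin {M N : NilCat P.FullSubcategory} {g h : M ⟶ N}
    (w : ∀ x, Hom.lin g x = Hom.lin h x) : g = h :=
  Hom.ext (ObjectProperty.hom_ext _ (ModuleCat.hom_ext (LinearMap.ext w)))

theorem isNilpotent_linν (M : NilCat P.FullSubcategory) : IsNilpotent M.linν := by
  obtain ⟨n, hn⟩ := M.nilpotent
  refine ⟨n, ?_⟩
  have h := congrArg (P.ι.mapEnd M.X) hn
  rw [map_pow] at h
  have h' := congrArg (ModuleCat.endRingEquiv M.X.obj) h
  rw [map_pow] at h'
  exact h'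

/-- The object of `Nil(C)` given by a module in `C` with a nilpotent endomorphism. -/
def ofModule (M : P.FullSubcategory) (ν : M.obj →ₗ[R] M.obj) (hν : IsNilpotent ν) :
    NilCat P.FullSubcategory where
  X := M
  ν := ObjectProperty.homMk (ModuleCat.ofHom ν)
  nilpotent := by
    obtain ⟨n, hn⟩ := hν
    have key : ∀ k : ℕ,
        (End.of (ObjectProperty.homMk (ModuleCat.ofHom ν) : M ⟶ M)) ^ k =
          End.of (ObjectProperty.homMk (ModuleCat.ofHom (ν ^ k)) : M ⟶ M) := by
      intro k
      induction k with
      | zero => rfl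
      | succ k ih => rw [pow_succ, ih, pow_succ]; rfl
    exact ⟨n, by rw [key, hn]; rfl⟩

/-- The morphism of `Nil(C)` given by a linear map. -/
def homOfLin {M N : NilCat P.FullSubcategory} (g : M.X.obj →ₗ[R] N.X.obj)
    (hg : ∀ x, g (M.linν x) = N.linν (g x)) : M ⟶ N where
  f := ObjectProperty.homMk (ModuleCat.ofHom g)
  comm := ObjectProperty.hom_ext _ (ModuleCat.hom_ext (LinearMap.ext hg))

/-- Reduces every exactness check below to elements of the underlying modules. -/
theorem isSES_iff (S : ShortComplex (NilCat P.FullSubcategory)) :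
    IsSES S ↔ Function.Injective (Hom.lin S.f) ∧ Function.Exact (Hom.lin S.f) (Hom.lin S.g) ∧
      Function.Surjective (Hom.lin S.g) := by
  change ((S.map (forget P.FullSubcategory)).map P.ι).ShortExact ↔ _
  constructor
  · intro h
    exact ⟨h.moduleCat_injective_f,
      (ShortComplex.ShortExact.moduleCat_exact_iff_function_exact _).1 h.exact,
      h.moduleCat_surjective_g⟩
  · rintro ⟨h₁, h₂, h₃⟩
    exact
      { exact := (ShortComplex.ShortExact.moduleCat_exact_iff_function_exact _).2 h₂
        mono_f := (ModuleCat.mono_iff_injective _).2 h₁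
        epi_g := (ModuleCat.epi_iff_surjective _).2 h₃ }

theorem isZero_iff (M : NilCat P.FullSubcategory) : IsZero M ↔ Subsingleton M.X.obj := by
  rw [IsZero.iff_id_eq_zero]
  constructor
  · intro h
    have h0 : ∀ x : M.X.obj, x = 0 := fun x => congrArg (fun g : M ⟶ M => Hom.lin g x) h
    exact ⟨fun x y => (h0 x).trans (h0 y).symm⟩
  · intro h
    exact Hom.ext_lin fun x => Subsingleton.elim _ _

end NilCat

/-! ### The stabilization of an acyclic binary complex -/

section Stabilization

variable {R : Type u} [CommRing R]

/-- Upward induction on the degree: a common complement of `Z_i` and `Z'_i` yields one of `Z_{i+1}`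
and `Z'_{i+1}`, since `X_{i+1}` splits both as `Z_{i+1} ⊕ Z_i` and as `Z'_{i+1} ⊕ Z'_i`. -/
theorem exists_complements {X Z Z' : ℤ → NilCat (ProjCat R)}
    {p : ∀ i, X (i + 1) ⟶ Z i} {j : ∀ i, Z i ⟶ X i}
    {p' : ∀ i, X (i + 1) ⟶ Z' i} {j' : ∀ i, Z' i ⟶ X i}
    (h : ∀ i, ∃ w : j (i + 1) ≫ p i = 0, IsSES (ShortComplex.mk (j (i + 1)) (p i) w))
    (h' : ∀ i, ∃ w : j' (i + 1) ≫ p' i = 0, IsSES (ShortComplex.mk (j' (i + 1)) (p' i) w))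
    (hX : ∃ a b : ℤ, ∀ i : ℤ, i < a ∨ b < i → IsZero (X i)) :
    ∃ Q : ℤ → ModuleCat.{u} R, (∀ i, Module.Finite R (Q i)) ∧ (∀ i, Module.Projective R (Q i)) ∧
      (∀ i, Module.Free R ((Z i).X.obj × Q i)) ∧ (∀ i, Module.Free R ((Z' i).X.obj × Q i)) ∧
      ∃ a b : ℤ, ∀ i : ℤ, i < a ∨ b < i → Subsingleton (Q i) := by
  obtain ⟨a, b, hab⟩ := hX
  -- The cycles in degree `i` embed in `X i`.
  have sub : ∀ i, IsZero (X i) → Subsingleton (Z i).X.obj ∧ Subsingleton (Z' i).X.obj := by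
    intro i hi
    have := (NilCat.isZero_iff _).1 hi
    obtain ⟨k, rfl⟩ : ∃ k, i = k + 1 := ⟨i - 1, by ring⟩
    obtain ⟨_, hk⟩ := h k
    obtain ⟨_, hk'⟩ := h' k
    exact ⟨((NilCat.isSES_iff _).1 hk).1.subsingleton, ((NilCat.isSES_iff _).1 hk').1.subsingleton⟩
  have zero : ∀ i, IsZero (X i) → ∃ Q : ModuleCat.{u} R, Module.Finite R Q ∧
      Module.Projective R Q ∧ Module.Free R ((Z i).X.obj × Q) ∧ Module.Free R ((Z' i).X.obj × Q) ∧
      (IsZero (X i) → Subsingleton Q) := by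
    intro i hi
    obtain ⟨h₁, h₂⟩ := sub i hi
    exact ⟨ModuleCat.of R PUnit.{u + 1}, inferInstanceAs (Module.Finite R PUnit.{u + 1}),
      inferInstanceAs (Module.Projective R PUnit.{u + 1}),
      inferInstanceAs (Module.Free R ((Z i).X.obj × PUnit.{u + 1})),
      inferInstanceAs (Module.Free R ((Z' i).X.obj × PUnit.{u + 1})),
      fun _ => inferInstanceAs (Subsingleton PUnit.{u + 1})⟩
  have main : ∀ i, a - 1 ≤ i → ∃ Q : ModuleCat.{u} R, Module.Finite R Q ∧
      Module.Projective R Q ∧ Module.Free R ((Z i).X.obj × Q) ∧ Module.Free R ((Z' i).X.obj × Q) ∧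
      (IsZero (X i) → Subsingleton Q) := by
    intro i hi
    induction i, hi using Int.leInduction with
    | base => exact zero _ (hab _ (Or.inl (by omega)))
    | succ i hi ih =>
      -- The inductive construction need not return zero where `X` vanishes. Restarting with `Q = 0`
      -- there keeps `Q` bounded.
      by_cases hz : IsZero (X (i + 1))
      · exact zero _ hz
      obtain ⟨Q, h₁, h₂, h₃, h₄, -⟩ := ih
      obtain ⟨_, hk⟩ := h i
      obtain ⟨_, hk'⟩ := h' i
      obtain ⟨k₁, k₂, k₃⟩ := (NilCat.isSES_iff _).1 hk
      obtain ⟨k₁', k₂', k₃'⟩ := (NilCat.isSES_iff _).1 hk'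
      have := (Z i).X.property.1
      have := (Z i).X.property.2
      have := (Z' i).X.property.1
      have := (Z' i).X.property.2
      have := (X (i + 1)).X.property.1
      have := (X (i + 1)).X.property.2
      obtain ⟨e⟩ := nonempty_equiv_prod_of_exact k₁ k₂ k₃
      obtain ⟨e'⟩ := nonempty_equiv_prod_of_exact k₁' k₂' k₃'
      obtain ⟨Q', hQ⟩ := exists_common_complement (Q := Q) e e'
      exact ⟨Q', hQ.1, hQ.2.1, hQ.2.2.1, hQ.2.2.2, fun h => absurd h hz⟩
  have all : ∀ i, ∃ Q : ModuleCat.{u} R, Module.Finite R Q ∧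
      Module.Projective R Q ∧ Module.Free R ((Z i).X.obj × Q) ∧ Module.Free R ((Z' i).X.obj × Q) ∧
      (IsZero (X i) → Subsingleton Q) := fun i =>
    if hi : a - 1 ≤ i then main i hi else zero i (hab i (Or.inl (by omega)))
  choose Q h₁ h₂ h₃ h₄ h₅ using all
  exact ⟨Q, h₁, h₂, h₃, h₄, a, b, fun i hi => h₅ i (hab i hi)⟩

/-- The graded module `Q_* ⊕ Q_{*-1}`. -/
abbrev coneModule (Q : ℤ → ModuleCat.{u} R) (i : ℤ) : Type u :=
  Q i × Q (i - 1)

/-- The isomorphism `Q_{(i + 1) - 1} ≃ Q_i`. -/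
def shiftEquiv (Q : ℤ → ModuleCat.{u} R) (i : ℤ) : Q (i + 1 - 1) ≃ₗ[R] Q i :=
  (eqToIso (congrArg Q (add_sub_cancel_right i 1))).toLinearEquiv

variable (Q : ℤ → ModuleCat.{u} R)

/-- The projection of `Q_{i+1} ⊕ Q_i` onto `Q_i`. -/
def conePr (i : ℤ) : coneModule Q (i + 1) →ₗ[R] Q i :=
  (shiftEquiv Q i).toLinearMap ∘ₗ LinearMap.snd R _ _

theorem conePr_surjective (i : ℤ) : Function.Surjective (conePr Q i) :=
  (shiftEquiv Q i).surjective.comp Prod.snd_surjective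

theorem conePr_eq_zero_iff (i : ℤ) (x : coneModule Q (i + 1)) : conePr Q i x = 0 ↔ x.2 = 0 :=
  (shiftEquiv Q i).map_eq_zero_iff

theorem isNilpotent_prodMap_zero {M N : Type u} [AddCommGroup M] [Module R M] [AddCommGroup N]
    [Module R N] {ν : M →ₗ[R] M} (hν : IsNilpotent ν) :
    IsNilpotent (LinearMap.prodMap ν (0 : N →ₗ[R] N)) := by
  have h : IsNilpotent ((ν, 0) : (M →ₗ[R] M) × (N →ₗ[R] N)) := by
    obtain ⟨n, hn⟩ := hν
    -- The exponent `n` does not suffice: for `n = 0` the zero endomorphism of `N` has power `1`.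
    exact ⟨n + 1, Prod.ext (by simp [pow_succ, hn]) (by simp)⟩
  exact h.map (LinearMap.prodMapRingHom R M N)

/-- The object `(M ⊕ Q, ν ⊕ 0)` of `Nil(Free(R))`. -/
def NilCat.prodZero (M : NilCat (ProjCat R)) (N : Type u) [AddCommGroup N] [Module R N]
    [Module.Finite R N] (hF : Module.Free R (M.X.obj × N)) : NilCat (FreeCat R) :=
  NilCat.ofModule ⟨ModuleCat.of R (M.X.obj × N), by
      have := M.X.property.1
      exact ⟨inferInstanceAs (Module.Finite R (M.X.obj × N)), hF⟩⟩
    (LinearMap.prodMap M.linν (0 : N →ₗ[R] N)) (isNilpotent_prodMap_zero M.isNilpotent_linν)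

/-- The morphism `g ⊕ h` between objects of the form `(M ⊕ Q, ν ⊕ 0)`. -/
def NilCat.prodZeroMap {M M' : NilCat (ProjCat R)} {N N' : Type u} [AddCommGroup N] [Module R N]
    [Module.Finite R N] [AddCommGroup N'] [Module R N'] [Module.Finite R N']
    (hF : Module.Free R (M.X.obj × N)) (hF' : Module.Free R (M'.X.obj × N'))
    (g : M ⟶ M') (h : N →ₗ[R] N') : NilCat.prodZero M N hF ⟶ NilCat.prodZero M' N' hF' :=
  NilCat.homOfLin (LinearMap.prodMap (NilCat.Hom.lin g) h) fun _ =>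
    Prod.ext (NilCat.Hom.lin_comm g _) (h.map_zero)

theorem subsingleton_coneModule_of_bounded
    (hQ : ∃ a b : ℤ, ∀ i : ℤ, i < a ∨ b < i → Subsingleton (Q i)) :
    ∃ a b : ℤ, ∀ i : ℤ, i < a ∨ b < i → Subsingleton (coneModule Q i) := by
  obtain ⟨a, b, h⟩ := hQ
  -- The summand `Q (i - 1)` moves the upper bound by one.
  refine ⟨a, b + 1, fun i hi => ?_⟩
  have := h i (by omega)
  have := h (i - 1) (by omega)
  infer_instance

variable [∀ i, Module.Finite R (Q i)]

/-- The cone of the identity of `Q_*` has cycles `Q_i`, so those of the sum are `Z_i ⊕ Q_i`, free by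
`hZ`. Only one differential occurs, so the lemma applies to `d` and `d'` separately on the same
graded object. -/
theorem isAcyclic_prodZero {X Z : ℤ → NilCat (ProjCat R)} {d : ∀ i, X (i + 1) ⟶ X i}
    {p : ∀ i, X (i + 1) ⟶ Z i} {j : ∀ i, Z i ⟶ X i} (hd : ∀ i, p i ≫ j i = d i)
    (h : ∀ i, ∃ w : j (i + 1) ≫ p i = 0, IsSES (ShortComplex.mk (j (i + 1)) (p i) w))
    (hZ : ∀ i, Module.Free R ((Z i).X.obj × Q i))
    (hX : ∀ i, Module.Free R ((X i).X.obj × coneModule Q i)) :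
    IsAcyclic (fun i => NilCat.prodZero (X i) (coneModule Q i) (hX i))
      (fun i => NilCat.prodZeroMap (hX (i + 1)) (hX i) (d i)
        (LinearMap.inl R _ _ ∘ₗ conePr Q i)) := by
  refine ⟨fun i => NilCat.prodZero (Z i) (Q i) (hZ i),
    fun i => NilCat.prodZeroMap _ _ (p i) (conePr Q i),
    fun i => NilCat.prodZeroMap _ _ (j i) (LinearMap.inl R _ _), fun i => ?_, fun i => ?_⟩
  · refine NilCat.Hom.ext_lin fun x => Prod.ext ?_ rfl
    exact congrArg (fun g : X (i + 1) ⟶ X i => NilCat.Hom.lin g x.1) (hd i)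
  · obtain ⟨w, hw⟩ := h i
    obtain ⟨h₁, h₂, h₃⟩ := (NilCat.isSES_iff _).1 hw
    refine ⟨NilCat.Hom.ext_lin fun x => Prod.ext ?_ ?_, (NilCat.isSES_iff _).2 ⟨?_, ?_, ?_⟩⟩
    · exact congrArg (fun g : Z (i + 1) ⟶ Z i => NilCat.Hom.lin g x.1) w
    · exact (conePr_eq_zero_iff Q i _).2 rfl
    · exact h₁.prodMap LinearMap.inl_injective
    · rintro ⟨x, y⟩
      constructor
      · intro hx
        obtain ⟨z, hz⟩ := (h₂ x).1 (congrArg Prod.fst hx)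
        exact ⟨(z, y.1), Prod.ext hz
          (Prod.ext rfl ((conePr_eq_zero_iff Q i y).1 (congrArg Prod.snd hx)).symm)⟩
      · rintro ⟨⟨z, y'⟩, hz⟩
        refine Prod.ext ((h₂ x).2 ⟨z, congrArg Prod.fst hz⟩)
          ((conePr_eq_zero_iff Q i y).2 (congrArg (fun t => t.2.2) hz).symm)
    · exact h₃.prodMap (conePr_surjective Q i)

variable [∀ i, Module.Projective R (Q i)]

/-- The object `Q_i ⊕ Q_{i-1}` of `Nil(P(R))`, with zero endomorphism. -/
def coneObj (i : ℤ) : NilCat (ProjCat R) :=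
  NilCat.ofModule ⟨ModuleCat.of R (coneModule Q i),
    inferInstanceAs (Module.Finite R (coneModule Q i)),
    inferInstanceAs (Module.Projective R (coneModule Q i))⟩ 0 IsNilpotent.zero

/-- The differential of the cone of the identity of `Q_*`. -/
def coneD (i : ℤ) : coneObj Q (i + 1) ⟶ coneObj Q i :=
  NilCat.homOfLin (LinearMap.inl R _ _ ∘ₗ conePr Q i) fun _ => LinearMap.map_zero _

theorem coneD_comp_coneD (i : ℤ) : coneD Q (i + 1) ≫ coneD Q i = 0 :=
  NilCat.Hom.ext_lin fun _ => Prod.ext ((conePr_eq_zero_iff Q i _).2 rfl) rfl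

theorem isAcyclic_coneD : IsAcyclic (coneObj Q) (coneD Q) := by
  refine ⟨fun i => NilCat.ofModule ⟨Q i, inferInstance, inferInstance⟩ 0 IsNilpotent.zero,
    fun i => NilCat.homOfLin (M := coneObj Q (i + 1)) (conePr Q i) fun _ => (conePr Q i).map_zero,
    fun i => NilCat.homOfLin (N := coneObj Q i) (LinearMap.inl R (Q i) (Q (i - 1))) fun _ =>
      (LinearMap.inl R (Q i) (Q (i - 1))).map_zero,
    fun _ => rfl, fun i => ?_⟩
  refine ⟨NilCat.Hom.ext_lin fun _ => (conePr_eq_zero_iff Q i _).2 rfl,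
    (NilCat.isSES_iff _).2 ⟨LinearMap.inl_injective (R := R) (M := Q (i + 1)),
      fun y => ⟨fun hy => ?_, ?_⟩,
      conePr_surjective Q i⟩⟩
  · exact ⟨y.1, Prod.ext rfl ((conePr_eq_zero_iff Q i y).1 hy).symm⟩
  · rintro ⟨x, rfl⟩
    exact (conePr_eq_zero_iff Q i _).2 rfl

/-- The cone of the identity of `Q_*`, as a diagonal acyclic binary complex. -/
def cone (hQ : ∃ a b : ℤ, ∀ i : ℤ, i < a ∨ b < i → Subsingleton (Q i)) :
    AcyclicBinary (NilCat (ProjCat R)) where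
  obj :=
    { X := coneObj Q
      d := coneD Q
      d' := coneD Q
      d_comp_d := coneD_comp_coneD Q
      d'_comp_d' := coneD_comp_coneD Q
      bounded := by
        obtain ⟨a, b, h⟩ := subsingleton_coneModule_of_bounded Q hQ
        exact ⟨a, b, fun i hi => (NilCat.isZero_iff _).2 (h i hi)⟩ }
  property := ⟨isAcyclic_coneD Q, isAcyclic_coneD Q⟩

end Stabilization

/-! ### Classes in `K₁`, passage to free modules, and generators of `Nil₁` -/

theorem K1.mk_eq_zero_of_isDiagonal {C : Type u} [Category.{v} C] [HasZeroMorphisms C]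
    [ExactSequences C] {T : AcyclicBinary C} (hT : T.obj.IsDiagonal) : K1.mk T = 0 :=
  (QuotientAddGroup.eq_zero_iff _).2 (AddSubgroup.subset_closure (Or.inr ⟨T, hT, rfl⟩))

theorem K1.mk_add_mk_of_isSES {C : Type u} [Category.{v} C] [HasZeroMorphisms C]
    [ExactSequences C] {S : ShortComplex (AcyclicBinary C)} (hS : IsSES S) :
    K1.mk S.X₁ + K1.mk S.X₃ = K1.mk S.X₂ :=
  sub_eq_zero.1 ((QuotientAddGroup.eq_zero_iff _).2
    (AddSubgroup.subset_closure (Or.inl ⟨S, hS, rfl⟩)))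

/-- Every class of an object of `B^q(Nil(P(R)))` is that of an object of `B^q(Nil(Free(R)))`. -/
theorem exists_freeNilClass_eq_mk {R : Type u} [CommRing R]
    (M : AcyclicBinary (NilCat (ProjCat R))) :
    ∃ N : AcyclicBinary (NilCat (FreeCat R)), freeNilClass N = K1.mk M := by
  obtain ⟨⟨Z, p, j, hd, h⟩, Z', p', j', hd', h'⟩ := M.property
  obtain ⟨Q, _, _, hZ, hZ', hQ⟩ := exists_complements h h' M.obj.bounded
  -- Splitting `X_i` as `Z_i ⊕ Z_{i-1}` turns the module into `(Z_i ⊕ Q_i) ⊕ (Z_{i-1} ⊕ Q_{i-1})`.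
  have hX : ∀ i, Module.Free R ((M.obj.X i).X.obj × coneModule Q i) := by
    intro i
    obtain ⟨k, rfl⟩ : ∃ k, i = k + 1 := ⟨i - 1, by ring⟩
    obtain ⟨_, hk⟩ := h k
    obtain ⟨h₁, h₂, h₃⟩ := (NilCat.isSES_iff _).1 hk
    have := (Z k).X.property.2
    obtain ⟨e⟩ := nonempty_equiv_prod_of_exact h₁ h₂ h₃
    exact Module.Free.of_equiv ((e.prodCongr ((LinearEquiv.refl R (Q (k + 1))).prodCongr
      (shiftEquiv Q k))).trans (LinearEquiv.prodProdProdComm R _ _ _ _)).symm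
  let N : AcyclicBinary (NilCat (FreeCat R)) :=
    { obj :=
      { X := fun i => NilCat.prodZero (M.obj.X i) (coneModule Q i) (hX i)
        d := fun i => NilCat.prodZeroMap (hX (i + 1)) (hX i) (M.obj.d i)
          (LinearMap.inl R _ _ ∘ₗ conePr Q i)
        d' := fun i => NilCat.prodZeroMap (hX (i + 1)) (hX i) (M.obj.d' i)
          (LinearMap.inl R _ _ ∘ₗ conePr Q i)
        d_comp_d := fun i => NilCat.Hom.ext_lin fun x => Prod.ext
          (congrArg (fun g : M.obj.X (i + 1 + 1) ⟶ M.obj.X i => NilCat.Hom.lin g x.1)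
            (M.obj.d_comp_d i))
          (Prod.ext ((conePr_eq_zero_iff Q i _).2 rfl) rfl)
        d'_comp_d' := fun i => NilCat.Hom.ext_lin fun x => Prod.ext
          (congrArg (fun g : M.obj.X (i + 1 + 1) ⟶ M.obj.X i => NilCat.Hom.lin g x.1)
            (M.obj.d'_comp_d' i))
          (Prod.ext ((conePr_eq_zero_iff Q i _).2 rfl) rfl)
        bounded := by
          obtain ⟨a, b, hab⟩ := M.obj.bounded
          obtain ⟨a', b', hab'⟩ := subsingleton_coneModule_of_bounded Q hQ
          refine ⟨min a a', max b b', fun i hi => (NilCat.isZero_iff _).2 ?_⟩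
          have := (NilCat.isZero_iff _).1 (hab i (by omega))
          have := hab' i (by omega)
          exact inferInstanceAs (Subsingleton ((M.obj.X i).X.obj × coneModule Q i)) }
      property := ⟨isAcyclic_prodZero Q hd h hZ hX, isAcyclic_prodZero Q hd' h' hZ' hX⟩ }
  -- The sequence `0 → cone → N → M → 0`, whose first term has class zero.
  let S : ShortComplex (AcyclicBinary (NilCat (ProjCat R))) :=
    { X₁ := cone Q hQ
      X₂ := (AcyclicBinary.map (NilCat.map (freeToProj R))).obj N
      X₃ := M
      f := ObjectProperty.homMk
        { f := fun i => NilCat.homOfLin (LinearMap.inr R _ _) fun _ =>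
            Prod.ext (LinearMap.map_zero _).symm rfl
          comm := fun i => NilCat.Hom.ext_lin fun x => Prod.ext (LinearMap.map_zero _).symm rfl
          comm' := fun i => NilCat.Hom.ext_lin fun x => Prod.ext (LinearMap.map_zero _).symm rfl }
      g := ObjectProperty.homMk
        { f := fun i => NilCat.homOfLin (LinearMap.fst R _ _) fun _ => rfl
          comm := fun i => rfl
          comm' := fun i => rfl }
      zero := rfl }
  have hS : IsSES S := fun i => (NilCat.isSES_iff _).2
    ⟨LinearMap.inr_injective (R := R) (M := (M.obj.X i).X.obj) (M₂ := coneModule Q i),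
      Function.Exact.inr_fst (R := R) (M := (M.obj.X i).X.obj) (N := coneModule Q i),
      LinearMap.fst_surjective (R := R) (M := (M.obj.X i).X.obj) (M₂ := coneModule Q i)⟩
  refine ⟨N, ?_⟩
  have e := K1.mk_add_mk_of_isSES hS
  rw [show K1.mk S.X₁ = 0 from K1.mk_eq_zero_of_isDiagonal rfl, zero_add] at e
  exact e.symm

/-- Holds already for complexes: replacing `ν` by `0` commutes with the inclusion of `Free(R)` in
`P(R)`. -/
theorem map_zero_map_forget_freeNilClass {R : Type u} [CommRing R]
    (N : AcyclicBinary (NilCat (FreeCat R))) :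
    K1.map (NilCat.zero (ProjCat R)) (K1.map (NilCat.forget (ProjCat R)) (freeNilClass N)) =
      freeNilClass (killNil N) := by
  simp only [freeNilClass, K1.map_mk]
  rfl

theorem map_forget_freeNilClass_killNil {R : Type u} [CommRing R]
    (N : AcyclicBinary (NilCat (FreeCat R))) :
    K1.map (NilCat.forget (ProjCat R)) (freeNilClass (killNil N)) =
      K1.map (NilCat.forget (ProjCat R)) (freeNilClass N) := by
  simp only [freeNilClass, K1.map_mk]
  rfl

theorem freeNilClass_eq_zero_of_isDiagonal {R : Type u} [CommRing R]
    {N : AcyclicBinary (NilCat (FreeCat R))} (h : N.obj.IsDiagonal) : freeNilClass N = 0 :=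
  K1.mk_eq_zero_of_isDiagonal
    (funext fun i => congrArg (NilCat.map (freeToProj R)).map (congrFun h i))

theorem theorem5p4 (R : Type u) [CommRing R] :
    Nil1 R = AddSubgroup.closure
      {x : K1 (NilCat (ProjCat R)) | ∃ N : AcyclicBinary (NilCat (FreeCat R)),
        N.obj.d ≠ N.obj.d' ∧ x = freeNilClass N - freeNilClass (killNil N)} := by
  apply le_antisymm
  · intro x hx
    let φ : K1 (NilCat (ProjCat R)) →+ K1 (NilCat (ProjCat R)) :=
      AddMonoidHom.id _ -
        (K1.map (NilCat.zero (ProjCat R))).comp (K1.map (NilCat.forget (ProjCat R)))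
    have hφ : φ x = x := by
      change x - K1.map (NilCat.zero (ProjCat R)) (K1.map (NilCat.forget (ProjCat R)) x) = x
      rw [show K1.map (NilCat.forget (ProjCat R)) x = 0 from hx, map_zero, sub_zero]
    -- The summands of a representative of `x` need not lie in the kernel, but `φ` can be evaluated
    -- on each of them.
    rw [← hφ]
    obtain ⟨y, rfl⟩ := QuotientAddGroup.mk_surjective x
    clear hx hφ
    induction y using FreeAbelianGroup.induction_on with
    | zero => exact (map_zero φ).symm ▸ zero_mem _
    | of M =>
      obtain ⟨N, hN⟩ := exists_freeNilClass_eq_mk M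
      change φ (K1.mk M) ∈ _
      have e : φ (K1.mk M) = freeNilClass N - freeNilClass (killNil N) := by
        rw [← hN, ← map_zero_map_forget_freeNilClass]
        rfl
      rw [e]
      -- If the differentials agree, they also agree for `killNil N`, and both classes vanish.
      by_cases h : N.obj.d = N.obj.d'
      · have hk : (killNil N).obj.IsDiagonal :=
          funext fun i => congrArg (fun g => (NilCat.zero (FreeCat R)).map
            ((NilCat.forget (FreeCat R)).map g)) (congrFun h i)
        rw [freeNilClass_eq_zero_of_isDiagonal h, freeNilClass_eq_zero_of_isDiagonal hk, sub_zero]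
        exact zero_mem _
      · exact AddSubgroup.subset_closure ⟨N, h, rfl⟩
    | neg M ih => exact (map_neg φ (QuotientAddGroup.mk (FreeAbelianGroup.of M))).symm ▸ neg_mem ih
    | add y z hy hz =>
      exact (map_add φ (QuotientAddGroup.mk y) (QuotientAddGroup.mk z)).symm ▸ add_mem hy hz
  · rw [AddSubgroup.closure_le]
    rintro _ ⟨N, -, rfl⟩
    change K1.map (NilCat.forget (ProjCat R)) _ = 0
    rw [map_sub, map_forget_freeNilClass_killNil, sub_self]
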